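/- An ideal on a nonempty set $X$ is a family $\mathcal I\subseteq\mathcal P(X)$ with $X\notin\mathcal I$ that is closed under subsets and finite unions and contains all finite subsets of $X$. For ideals $\mathcal J$ on $Y$ and $\mathcal I$ on $X$, write $\mathcal J\le_K\mathcal I$ (Katětov order) if there is $f:X\to Y$ with $f^{-1}[A]\in\mathcal I$ for every $A\in\mathcal J$. For a countable ordinal $\beta\ge 2$, equip $\omega^\beta+1=[0,\omega^\beta]$ (ordinal exponentiation) with the order topology and let $\mathrm{conv}_\beta$ be the ideal on $\omega^\beta+1$ of all sets that can be covered by the ranges of finitely many convergent sequences in $\omega^\beta+1$. For a countable limit ordinal $\alpha$, put $$\mathrm{conv}_{<\alpha}=\{A\subseteq\omega^\alpha+1 : A\cap\omega^\beta\in\mathrm{conv}_\beta \text{ for all } 2\le\beta<\alpha\}.$$ Let $\alpha$ be a countable limit ordinal (in particular $\alpha\neq 0$). 1. $\mathrm{conv}_{<\alpha}$ is an ideal on $\omega^\alpha+1$ and it is a greatest lower bound of $\{\mathrm{conv}_\beta : 2\le\beta<\alpha\}$ in the Katětov order, i.e. (a) $\mathrm{conv}_{<\alpha}\le_K\mathrm{conv}_\beta$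 whenever $2\le\beta<\alpha$; (b) for every ideal $\mathcal I$ on any nonempty set, if $\mathcal I\le_K\mathrm{conv}_\beta$ for all $2\le\beta<\alpha$, then $\mathcal I\le_K\mathrm{conv}_{<\alpha}$. 2. $\mathrm{conv}_\alpha\le_K\mathrm{conv}_{<\alpha}$ and $\mathrm{conv}_{<\alpha}\not\le_K\mathrm{conv}_\alpha$. Consequently $\mathrm{conv}_\alpha$ is not a greatest lower bound of $\{\mathrm{conv}_\beta : 2\le\beta<\alpha\}$: some ideal lies Katětov-below every $\mathrm{conv}_\beta$, $2\le\beta<\alpha$, but not below $\mathrm{conv}_\alpha$. -/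

import Mathlib

open scoped Ordinal Topology

universe u v

/-- `I` is an ideal on the set `X`: a proper family of subsets, closed under finite unions and
subsets, which contains all finite sets. -/
structure IsIdealOn {X : Type*} (I : Set (Set X)) : Prop where
  empty_mem : ∅ ∈ I
  univ_notMem : Set.univ ∉ I
  union_mem : ∀ A B : Set X, A ∈ I → B ∈ I → A ∪ B ∈ I
  subset_mem : ∀ A B : Set X, A ⊆ B → B ∈ I → A ∈ I
  finite_mem : ∀ A : Set X, A.Finite → A ∈ I

/-- `J ≤_K I` (Katětov order), for `J` a family of subsets of `Y` and `I` one of subsets of `X`. -/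
def KatetovLE {X Y : Type*} (J : Set (Set Y)) (I : Set (Set X)) : Prop :=
  ∃ f : X → Y, ∀ A ∈ J, f ⁻¹' A ∈ I

/-- `conv(X)`: the subsets of the topological space `X` that are covered by the ranges of finitely
many convergent sequences of `X`. -/
def convFamily (X : Type*) [TopologicalSpace X] : Set (Set X) :=
  {A | ∃ (k : ℕ) (d : Fin k → ℕ → X),
    (∀ i, ∃ x, Filter.Tendsto (d i) Filter.atTop (𝓝 x)) ∧ A ⊆ ⋃ i, Set.range (d i)}

/-- The space `ω ^ α + 1`, i.e. the set of all ordinals below `ω ^ α + 1`. Its topology, inherited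
from the ordinals, is the order topology. -/
abbrev OmegaPowSucc (α : Ordinal) : Type _ := Set.Iio (ω ^ α + 1)

/-- `conv_α`. -/
def convOrd (α : Ordinal) : Set (Set (OmegaPowSucc α)) := convFamily (OmegaPowSucc α)

/-- `conv_{<α}`: the sets `A ⊆ ω ^ α + 1` with `A ∩ ω ^ β ∈ conv_β` for all `2 ≤ β < α`.
The set `A ∩ ω ^ β` is read as a set of ordinals and then as a subset of `ω ^ β + 1`. -/
def convLT (α : Ordinal) : Set (Set (OmegaPowSucc α)) :=
  {A | ∀ β : Ordinal, 2 ≤ β → β < α →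
    ((↑) : OmegaPowSucc β → Ordinal) ⁻¹'
      (((↑) : OmegaPowSucc α → Ordinal) '' A ∩ Set.Iio (ω ^ β)) ∈ convOrd β}

/-! A lower bound of the `conv_β` maps below `conv_{<α}` by gluing its reductions along an
enumeration of `[2, α)`: below each `ω ^ β` only finitely many pieces occur. Since `conv_α ⊆
conv_{<α}`, the identity reduces `conv_α` to `conv_{<α}`.

For non-reducibility, the invariant is that a set in `conv` has finitely many accumulation points.
Let `f` reduce `conv_{<α}` to `conv_α`, and consider the cluster values of `f` along punctured
neighbourhoods. Each value `y` occurs at finitely many points (`PreservesConv.finite_mapClusterPt`).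
Off a finite set, a point of Cantor–Bendixson rank at least `ρ ≥ 1` (a nonzero multiple of `ω ^ ρ`)
has a cluster value of rank at least `ρ` (`PreservesConv.exists_mapClusterPt_dvd`). Yet for some `β
< α` only finitely many points have a cluster value strictly between `ω ^ β` and `ω ^ α`
(`exists_finite_mapClusterPt_gt`). The infinitely many points of rank at least `β + 1` contradict
this. -/

open Filter Set

/-! ### Sets covered by finitely many convergent sequences -/

section ConvFamily

variable {X Y : Type*} [TopologicalSpace X] [TopologicalSpace Y]

theorem convFamily_mono {A B : Set X} (h : A ⊆ B) (hB : B ∈ convFamily X) : A ∈ convFamily X := by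
  obtain ⟨k, d, hd, hs⟩ := hB
  exact ⟨k, d, hd, h.trans hs⟩

theorem empty_mem_convFamily : (∅ : Set X) ∈ convFamily X :=
  ⟨0, Fin.elim0, fun i => i.elim0, empty_subset _⟩

theorem range_mem_convFamily {s : ℕ → X} {x : X} (h : Tendsto s atTop (𝓝 x)) :
    range s ∈ convFamily X :=
  ⟨1, fun _ => s, fun _ => ⟨x, h⟩, subset_iUnion (fun _ : Fin 1 => range s) 0⟩

theorem singleton_mem_convFamily (x : X) : {x} ∈ convFamily X := by
  simpa using range_mem_convFamily (tendsto_const_nhds (x := x) (f := (atTop : Filter ℕ)))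

theorem union_mem_convFamily {A B : Set X} (hA : A ∈ convFamily X) (hB : B ∈ convFamily X) :
    A ∪ B ∈ convFamily X := by
  obtain ⟨k, d, hd, hs⟩ := hA
  obtain ⟨l, e, he, ht⟩ := hB
  refine ⟨k + l, Fin.append d e, ?_, ?_⟩
  · intro i
    refine Fin.addCases (fun i => ?_) (fun i => ?_) i
    · simpa using hd i
    · simpa using he i
  · rintro x (hx | hx)
    · obtain ⟨i, hi⟩ := mem_iUnion.1 (hs hx)
      exact mem_iUnion.2 ⟨Fin.castAdd l i, by simpa using hi⟩
    · obtain ⟨i, hi⟩ := mem_iUnion.1 (ht hx)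
      exact mem_iUnion.2 ⟨Fin.natAdd k i, by simpa using hi⟩

theorem biUnion_mem_convFamily {ι : Type*} {t : Set ι} (ht : t.Finite) {A : ι → Set X}
    (h : ∀ i ∈ t, A i ∈ convFamily X) : ⋃ i ∈ t, A i ∈ convFamily X := by
  induction t, ht using Set.Finite.induction_on with
  | empty => simpa using empty_mem_convFamily
  | insert _ _ ih =>
    rw [biUnion_insert]
    exact union_mem_convFamily (h _ (mem_insert _ _)) (ih fun i hi => h i (mem_insert_of_mem _ hi))

theorem finite_mem_convFamily {A : Set X} (hA : A.Finite) : A ∈ convFamily X := by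
  have := biUnion_mem_convFamily hA fun x _ => singleton_mem_convFamily x
  simpa using this

theorem image_mem_convFamily {g : X → Y} (hg : Continuous g) {A : Set X}
    (hA : A ∈ convFamily X) : g '' A ∈ convFamily Y := by
  obtain ⟨k, d, hd, hs⟩ := hA
  refine ⟨k, fun i => g ∘ d i, fun i => ?_, ?_⟩
  · obtain ⟨x, hx⟩ := hd i
    exact ⟨g x, (hg.tendsto x).comp hx⟩
  · rintro _ ⟨a, ha, rfl⟩
    obtain ⟨i, n, rfl⟩ := mem_iUnion.1 (hs ha)
    exact mem_iUnion.2 ⟨i, n, rfl⟩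

/-- A countable set almost contained in every neighbourhood of `x` is covered by a convergent
sequence. -/
theorem mem_convFamily_of_forall_finite_diff {A : Set X} (hc : A.Countable) {x : X}
    (h : ∀ U ∈ 𝓝 x, (A \ U).Finite) : A ∈ convFamily X := by
  by_cases hA : A.Finite
  · exact finite_mem_convFamily hA
  have : Countable A := hc
  have : Infinite A := infinite_coe_iff.2 hA
  obtain ⟨e⟩ := nonempty_equiv_of_countable (α := ℕ) (β := A)
  have ht : Tendsto (fun n => (e n : X)) atTop (𝓝 x) := by
    intro U hU
    rw [← Nat.cofinite_eq_atTop, Filter.mem_map, mem_cofinite]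
    refine ((h U hU).preimage (f := fun n => (e n : X))
      ((Subtype.val_injective.comp e.injective).injOn)).subset fun n hn => ?_
    exact ⟨(e n).2, hn⟩
  refine convFamily_mono (fun a ha => ?_) (range_mem_convFamily ht)
  exact ⟨e.symm ⟨a, ha⟩, by simp⟩

/-- An accumulation point must be the limit of one of the covering sequences: near any other point
each sequence has only finitely many terms. -/
theorem finite_accPt_of_mem_convFamily [T2Space X] {A : Set X} (hA : A ∈ convFamily X) :
    {x | AccPt x (𝓟 A)}.Finite := by
  obtain ⟨k, d, hd, hs⟩ := hA
  choose l hl using hd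
  refine (finite_range l).subset fun x hx => ?_
  by_contra hne
  have hfar : ∀ i, ∀ᶠ z in 𝓝[≠] x, z ∉ range (d i) := by
    intro i
    have hxl : x ≠ l i := fun h => hne ⟨i, h.symm⟩
    obtain ⟨U, V, hU, hV, hxU, hlV, hUV⟩ := t2_separation hxl
    obtain ⟨N, hN⟩ := eventually_atTop.1 ((hl i).eventually (hV.mem_nhds hlV))
    have hfin : ((d i '' Iio N) \ {x}).Finite := ((finite_Iio N).image _).sdiff
    have h1 : ∀ᶠ z in 𝓝[≠] x, z ∈ ((d i '' Iio N) \ {x})ᶜ :=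
      mem_nhdsWithin_of_mem_nhds (hfin.isClosed.compl_mem_nhds fun h => h.2 rfl)
    have h2 : ∀ᶠ z in 𝓝[≠] x, z ∈ U := mem_nhdsWithin_of_mem_nhds (hU.mem_nhds hxU)
    filter_upwards [h1, h2, self_mem_nhdsWithin] with z hz1 hz2 hz3
    rintro ⟨n, rfl⟩
    rcases lt_or_ge n N with hn | hn
    · exact hz1 ⟨⟨n, hn, rfl⟩, hz3⟩
    · exact disjoint_left.1 hUV hz2 (hN n hn)
  have hA' : ∃ᶠ z in 𝓝[≠] x, z ∈ A := accPt_iff_frequently_nhdsNE.1 hx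
  obtain ⟨z, hz, hz'⟩ := (hA'.and_eventually (eventually_all.2 hfar)).exists
  obtain ⟨i, hi⟩ := mem_iUnion.1 (hs hz)
  exact hz' i hi

end ConvFamily

/-! ### The ideals as families of sets of ordinals, and the greatest lower bound -/

theorem mem_Iio_omegaPow_add_one_iff {β x : Ordinal.{u}} : x ∈ Iio (ω ^ β + 1) ↔ x ≤ ω ^ β :=
  mem_Iio.trans Order.lt_add_one_iff

/-- The continuous retraction `x ↦ min x (ω ^ β)` brings covering sequences back into the initial
segment, so different `β` can be compared inside `Ordinal`. -/
theorem mem_convOrd_iff {β : Ordinal.{u}} {B : Set (OmegaPowSucc β)} :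
    B ∈ convOrd β ↔ ((↑) : OmegaPowSucc β → Ordinal) '' B ∈ convFamily Ordinal := by
  refine ⟨image_mem_convFamily continuous_subtype_val, fun h => ?_⟩
  let r : Ordinal.{u} → OmegaPowSucc β := fun x =>
    ⟨min x (ω ^ β), mem_Iio_omegaPow_add_one_iff.2 (min_le_right _ _)⟩
  have hr : Continuous r := by
    apply Continuous.subtype_mk
    fun_prop
  refine convFamily_mono ?_ (image_mem_convFamily hr h)
  intro b hb
  refine ⟨b, ⟨b, hb, rfl⟩, Subtype.ext ?_⟩
  exact min_eq_left (mem_Iio_omegaPow_add_one_iff.1 b.2)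

theorem mem_convLT_iff {α : Ordinal.{u}} {A : Set (OmegaPowSucc α)} :
    A ∈ convLT α ↔ ∀ β : Ordinal.{u}, 2 ≤ β → β < α →
      ((↑) : OmegaPowSucc α → Ordinal) '' A ∩ Iio (ω ^ β) ∈ convFamily Ordinal := by
  refine forall_congr' fun β => forall_congr' fun _ => forall_congr' fun _ => ?_
  rw [mem_convOrd_iff, Subtype.image_preimage_coe, inter_eq_self_of_subset_right]
  exact fun x hx => mem_Iio_omegaPow_add_one_iff.2 (le_of_lt hx.2)

theorem convOrd_subset_convLT (α : Ordinal.{u}) : convOrd α ⊆ convLT α := fun _ hA =>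
  mem_convLT_iff.2 fun _ _ _ => convFamily_mono inter_subset_left (mem_convOrd_iff.1 hA)

theorem omegaPowSucc_subset {β α : Ordinal.{u}} (h : β ≤ α) :
    Iio (ω ^ β + 1) ⊆ Iio (ω ^ α + 1) :=
  Iio_subset_Iio (Order.succ_le_succ (Ordinal.opow_le_opow_right Ordinal.omega0_pos h))

theorem katetovLE_convLT_convOrd {α β : Ordinal.{u}} (h2 : 2 ≤ β) (hβ : β < α) :
    KatetovLE (convLT α) (convOrd β) := by
  refine ⟨inclusion (omegaPowSucc_subset hβ.le), fun A hA => mem_convOrd_iff.2 ?_⟩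
  -- `A ∩ ω ^ β` omits the endpoint `ω ^ β`, hence the extra singleton.
  refine convFamily_mono ?_
    (union_mem_convFamily (mem_convLT_iff.1 hA β h2 hβ) (singleton_mem_convFamily (ω ^ β)))
  rintro _ ⟨x, hx, rfl⟩
  rcases (mem_Iio_omegaPow_add_one_iff.1 x.2).lt_or_eq with h | h
  · exact Or.inl ⟨⟨_, hx, rfl⟩, h⟩
  · exact Or.inr h

theorem countable_Iio_of_lt_omega_one {o : Ordinal.{u}} (h : o < ω₁) : (Iio o).Countable := by
  rw [← Cardinal.le_aleph0_iff_set_countable, Cardinal.mk_Iio_ordinal, Cardinal.lift_le_aleph0]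
  rw [← Cardinal.ord_aleph, Cardinal.lt_ord, ← zero_add (1 : Ordinal.{u}), ← Cardinal.succ_aleph,
    Order.lt_succ_iff, Cardinal.aleph_zero] at h
  exact h

theorem countable_omegaPowSucc {α : Ordinal.{u}} (h : α < ω₁) : Countable (OmegaPowSucc α) := by
  apply Set.Countable.to_subtype
  apply countable_Iio_of_lt_omega_one
  have h1 : ω ^ α < ω₁ := Ordinal.isPrincipal_opow_omega 1 Ordinal.omega0_lt_omega_one h
  exact (Cardinal.isSuccLimit_omega 1).succ_lt h1

theorem KatetovLE.convLT {α : Ordinal.{u}} (hα : Order.IsSuccLimit α) (hcount : α < ω₁)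
    {Y : Type v} {I : Set (Set Y)}
    (h : ∀ β : Ordinal.{u}, 2 ≤ β → β < α → KatetovLE I (convOrd β)) :
    KatetovLE I (convLT α) := by
  classical
  have h2 : 2 < α := by exact_mod_cast Ordinal.natCast_lt_of_isSuccLimit hα 2
  have hc : (Ico 2 α).Countable :=
    (countable_Iio_of_lt_omega_one hcount).mono Ico_subset_Iio_self
  obtain ⟨e, he⟩ := hc.exists_eq_range ⟨2, le_rfl, h2⟩
  have hmem : ∀ n, e n ∈ Ico 2 α := fun n => he ▸ mem_range_self n
  choose f hf using fun n => h (e n) (hmem n).1 (hmem n).2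
  let g : OmegaPowSucc α → Y := fun x =>
    if hx : ∃ n, (x : Ordinal) < ω ^ e n + 1 then f (Nat.find hx) ⟨x, Nat.find_spec hx⟩
    -- Reached only at `x = ω ^ α`, which lies in no `Iio (ω ^ β)` with `β < α`; the value is
    -- irrelevant.
    else f 0 ⟨0, mem_Iio_omegaPow_add_one_iff.2 zero_le⟩
  refine ⟨g, fun A hA => mem_convLT_iff.2 fun β hβ hβα => ?_⟩
  obtain ⟨m, rfl⟩ : β ∈ range e := he ▸ ⟨hβ, hβα⟩
  refine convFamily_mono ?_ (biUnion_mem_convFamily (finite_Iic m)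
    fun n _ => mem_convOrd_iff.1 (hf n A hA))
  rintro _ ⟨⟨x, hx, rfl⟩, hxm⟩
  have hex : ∃ n, (x : Ordinal) < ω ^ e n + 1 := ⟨m, hxm.trans (Order.lt_add_one_iff.2 le_rfl)⟩
  have hle : Nat.find hex ≤ m := Nat.find_min' hex (hxm.trans (Order.lt_add_one_iff.2 le_rfl))
  refine mem_iUnion₂.2 ⟨Nat.find hex, hle, ⟨x, Nat.find_spec hex⟩, ?_, rfl⟩
  have : g x = f (Nat.find hex) ⟨x, Nat.find_spec hex⟩ := dif_pos hex
  rwa [mem_preimage, this] at hx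

theorem Ordinal.accPt_iff_forall_lt {o : Ordinal.{u}} {S : Set Ordinal.{u}} :
    AccPt o (𝓟 S) ↔ o ≠ 0 ∧ ∀ p < o, ∃ w ∈ S, p < w ∧ w < o := by
  rw [SuccOrder.accPt_principal]
  simp [Set.Nonempty]

theorem Ordinal.isSuccLimit_omega0_mul {b : Ordinal.{u}} (hb : 0 < b) :
    Order.IsSuccLimit (ω * b) :=
  Ordinal.isSuccLimit_mul_left Ordinal.isSuccLimit_omega0 hb

/-- The points `ω * (n + 1)` are infinitely many accumulation points. This makes `conv_{<α}` proper.
-/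
theorem Iio_omega0_sq_notMem_convFamily : Iio (ω ^ (2 : Ordinal.{u})) ∉ convFamily Ordinal := by
  intro h
  refine Set.Infinite.mono (s := range fun n : ℕ => ω * ((n : Ordinal.{u}) + 1)) ?_
    (infinite_range_of_injective ?_) (finite_accPt_of_mem_convFamily h)
  · rintro _ ⟨n, rfl⟩
    have hl : Order.IsSuccLimit (ω * ((n : Ordinal.{u}) + 1)) :=
      Ordinal.isSuccLimit_omega0_mul (Order.lt_add_one_iff.2 zero_le)
    have hlt : ω * ((n : Ordinal.{u}) + 1) < ω ^ (2 : Ordinal.{u}) := by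
      rw [← one_add_one_eq_two, Ordinal.opow_add, Ordinal.opow_one]
      exact mul_lt_mul_of_pos_left (by exact_mod_cast Ordinal.natCast_lt_omega0 (n + 1))
        Ordinal.omega0_pos
    refine Ordinal.accPt_iff_forall_lt.2 ⟨hl.ne_bot, fun p hp => ?_⟩
    exact ⟨Order.succ p, (hl.succ_lt hp).trans hlt, Order.lt_succ p, hl.succ_lt hp⟩
  · intro m n hmn
    have := mul_left_cancel₀ Ordinal.omega0_ne_zero hmn
    exact_mod_cast Order.succ_injective this

theorem isIdealOn_convLT {α : Ordinal.{u}} (hα : Order.IsSuccLimit α) :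
    IsIdealOn (convLT α) where
  empty_mem := convOrd_subset_convLT α empty_mem_convFamily
  univ_notMem h := by
    have h2 : 2 < α := by exact_mod_cast Ordinal.natCast_lt_of_isSuccLimit hα 2
    refine Iio_omega0_sq_notMem_convFamily
      (convFamily_mono ?_ (mem_convLT_iff.1 h 2 le_rfl h2))
    refine fun x hx => ⟨⟨⟨x, ?_⟩, trivial, rfl⟩, hx⟩
    exact omegaPowSucc_subset h2.le (mem_Iio_omegaPow_add_one_iff.2 (le_of_lt hx))
  union_mem A B hA hB := by
    rw [mem_convLT_iff] at *
    intro β h1 h2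
    rw [image_union, union_inter_distrib_right]
    exact union_mem_convFamily (hA β h1 h2) (hB β h1 h2)
  subset_mem A B hAB hB := by
    rw [mem_convLT_iff] at *
    exact fun β h1 h2 => convFamily_mono (by gcongr) (hB β h1 h2)
  finite_mem A hA := convOrd_subset_convLT α (finite_mem_convFamily hA)

/-! ### Cluster values of maps that preserve smallness -/

section ClusterValues

variable {X Y : Type*} [TopologicalSpace X] [TopologicalSpace Y]

theorem MapClusterPt.exists_seq_nhdsNE [FirstCountableTopology X] [FirstCountableTopology Y]
    {f : X → Y} {x : X} {y : Y} (h : MapClusterPt y (𝓝[≠] x) f) {W : Set Y} (hW : W ∈ 𝓝 y) :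
    ∃ s : ℕ → X, Tendsto s atTop (𝓝[≠] x) ∧ Tendsto (f ∘ s) atTop (𝓝 y) ∧ ∀ k, f (s k) ∈ W := by
  obtain ⟨s, hfs, hs⟩ := MapClusterPt.exists_seq_tendsto h
  obtain ⟨N, hN⟩ := eventually_atTop.1 (hfs.eventually hW)
  exact ⟨fun k => s (k + N), hs.comp (tendsto_add_atTop_nat N),
    hfs.comp (tendsto_add_atTop_nat N), fun k => hN _ (Nat.le_add_left _ _)⟩

theorem accPt_of_tendsto_nhdsNE {x : X} {s : ℕ → X} {A : Set X}
    (hs : Tendsto s atTop (𝓝[≠] x)) (hA : ∀ k, s k ∈ A) : AccPt x (𝓟 A) :=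
  accPt_iff_frequently_nhdsNE.2 (hs.frequently (Frequently.of_forall hA))

theorem MapClusterPt.accPt {f : X → Y} {x : X} {y : Y} (h : MapClusterPt y (𝓝[≠] x) f)
    (hne : ∀ᶠ s in 𝓝[≠] x, f s ≠ y) : AccPt y (𝓟 univ) := by
  refine accPt_iff_nhds.2 fun U hU => ?_
  obtain ⟨s, hs, hs'⟩ := ((mapClusterPt_iff_frequently.1 h U hU).and_eventually hne).exists
  exact ⟨f s, ⟨hs, trivial⟩, hs'⟩

theorem Set.Finite.eventually_nhdsNE_notMem [T1Space X] {E : Set X} (hE : E.Finite) (x : X) :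
    ∀ᶠ w in 𝓝[≠] x, w ∉ E := by
  have h : (E \ {x})ᶜ ∈ 𝓝 x := hE.sdiff.isClosed.compl_mem_nhds fun h => h.2 rfl
  filter_upwards [mem_nhdsWithin_of_mem_nhds h, self_mem_nhdsWithin] with w hw hw' hwE
  exact hw ⟨hwE, hw'⟩

/-- The preimages under `f` of the sets covered by finitely many convergent sequences have
only finitely many accumulation points. -/
def PreservesConv (f : X → Y) : Prop :=
  ∀ A ∈ convFamily Y, {x | AccPt x (𝓟 (f ⁻¹' A))}.Finite

/-- Otherwise compactness extracts a convergent sequence from the values `c` at infinitely many such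
points, and the preimage of its range accumulates at infinitely many of them. -/
theorem PreservesConv.finite_frequently_eq [CompactSpace Y] [FirstCountableTopology Y]
    {f : X → Y} (hf : PreservesConv f) : {x | ∃ c, ∃ᶠ s in 𝓝[≠] x, f s = c}.Finite := by
  by_contra hinf
  let x := Set.Infinite.natEmbedding _ hinf
  choose c hc using fun n => (x n).2
  obtain ⟨y, φ, hφ, hy⟩ := CompactSpace.tendsto_subseq c
  refine Set.Infinite.mono (s := range fun n => (x (φ n) : X)) ?_
    (infinite_range_of_injective ?_) (hf _ (range_mem_convFamily hy))
  · rintro _ ⟨n, rfl⟩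
    refine accPt_iff_frequently_nhdsNE.2 ((hc (φ n)).mono fun s hs => ?_)
    exact ⟨n, hs.symm⟩
  · exact Subtype.val_injective.comp (x.injective.comp hφ.injective)

/-- A diagonal argument: given infinitely many such points `x n`, take sequences tending to `x n`
whose images tend to `y` inside `U n`. All the images together are almost contained in every
neighbourhood of `y`, so they form a set in `conv`. -/
theorem PreservesConv.finite_mapClusterPt [FirstCountableTopology X] [FirstCountableTopology Y]
    {f : X → Y} (hf : PreservesConv f) (y : Y) : {x | MapClusterPt y (𝓝[≠] x) f}.Finite := by
  by_contra hinf
  let x := Set.Infinite.natEmbedding _ hinf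
  obtain ⟨U, hU⟩ := (𝓝 y).exists_antitone_basis
  choose s hs hfs hsU using fun n => MapClusterPt.exists_seq_nhdsNE (x n).2 (hU.mem n)
  have hA : (⋃ n, range (f ∘ s n)) ∈ convFamily Y := by
    refine mem_convFamily_of_forall_finite_diff (x := y)
      (countable_iUnion fun n => countable_range _) fun V hV => ?_
    obtain ⟨m, hm⟩ := hU.mem_iff.1 hV
    have hN : ∀ n, ∃ N, ∀ k ≥ N, f (s n k) ∈ V := fun n => eventually_atTop.1 ((hfs n).eventually hV)
    choose N hN using hN
    refine ((finite_Iio m).biUnion fun n _ => (finite_Iio (N n)).image (f ∘ s n)).subset ?_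
    rintro z ⟨hz, hzV⟩
    obtain ⟨n, k, rfl⟩ := mem_iUnion.1 hz
    have hnm : n < m := not_le.1 fun h => hzV (hm (hU.antitone h (hsU n k)))
    exact mem_iUnion₂.2 ⟨n, hnm, k, not_le.1 fun h => hzV (hN n k h), rfl⟩
  refine Set.Infinite.mono (s := range fun n => (x n : X)) ?_
    (infinite_range_of_injective (Subtype.val_injective.comp x.injective)) (hf _ hA)
  rintro _ ⟨n, rfl⟩
  exact accPt_of_tendsto_nhdsNE (hs n) fun k => mem_iUnion.2 ⟨n, k, rfl⟩

end ClusterValues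

/-! ### Cantor–Bendixson rank as divisibility by powers of `ω` -/

namespace Ordinal

theorem omega0_opow_add_one_dvd_of_accPt {σ y : Ordinal.{u}}
    (h : AccPt y (𝓟 {w | ω ^ σ ∣ w})) : ω ^ (σ + 1) ∣ y := by
  obtain ⟨hy, h⟩ := accPt_iff_forall_lt.1 h
  have hpos : 0 < ω ^ σ := opow_pos σ omega0_pos
  have hlt : y < ω ^ σ * (y / ω ^ σ + 1) := lt_mul_succ_div y hpos.ne'
  have heq : ω ^ σ * (y / ω ^ σ) = y := by
    -- No multiple of `ω ^ σ` lies strictly between `ω ^ σ * (y / ω ^ σ)` and `y`.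
    refine (mul_div_le y _).eq_or_lt.resolve_right fun hl => ?_
    obtain ⟨_, ⟨e, rfl⟩, h1, h2⟩ := h _ hl
    have := lt_of_mul_lt_mul_left h1 zero_le
    have := lt_of_mul_lt_mul_left (h2.trans hlt) zero_le
    exact (Order.lt_add_one_iff.1 this).not_gt ‹_›
  rw [opow_add, opow_one, ← heq]
  -- The quotient is not a successor `e + 1`, as no multiple lies strictly between `ω ^ σ * e` and
  -- `ω ^ σ * (e + 1)`.
  refine mul_dvd_mul_left _ (isSuccPrelimit_iff_omega0_dvd.1 ?_)
  refine Order.isSuccPrelimit_of_succ_ne fun e he => ?_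
  rw [← heq, ← he] at h
  obtain ⟨_, ⟨e', rfl⟩, h1, h2⟩ := h _ (mul_lt_mul_of_pos_left (Order.lt_succ e) hpos)
  exact (Order.lt_succ_iff.1 (lt_of_mul_lt_mul_left h2 zero_le)).not_gt
    (lt_of_mul_lt_mul_left h1 zero_le)

/-- The remainder modulo `ω ^ ρ` is below some `ω ^ σ` with `σ < ρ` and divisible by it, hence zero.
-/
theorem omega0_opow_dvd_of_forall_lt {ρ y : Ordinal.{u}} (hρ : Order.IsSuccLimit ρ)
    (h : ∀ σ < ρ, ω ^ σ ∣ y) : ω ^ ρ ∣ y := by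
  rw [dvd_iff_mod_eq_zero]
  by_contra hr
  obtain ⟨σ, hσ, hlt⟩ := (lt_opow_of_isSuccLimit omega0_ne_zero hρ).1
    (mod_lt y (opow_pos ρ omega0_pos).ne')
  have hd := h σ hσ
  rw [← div_add_mod y (ω ^ ρ), dvd_add_iff ((opow_dvd_opow ω hσ.le).mul_right _)] at hd
  exact (le_of_dvd hr hd).not_gt hlt

theorem omega0_opow_dvd_of_accPt {ρ y : Ordinal.{u}}
    (h : ∀ σ < ρ, AccPt y (𝓟 {w | ω ^ σ ∣ w})) : ω ^ ρ ∣ y := by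
  rcases zero_or_succ_or_isSuccLimit ρ with rfl | ⟨σ, rfl⟩ | hρ
  · simp
  · exact omega0_opow_add_one_dvd_of_accPt (h σ (Order.lt_succ σ))
  · exact omega0_opow_dvd_of_forall_lt hρ fun σ hσ =>
      (opow_dvd_opow ω (Order.le_succ σ)).trans (omega0_opow_add_one_dvd_of_accPt (h σ hσ))

theorem accPt_of_omega0_opow_dvd {σ ρ x : Ordinal.{u}} (hσ : σ < ρ) (hx : x ≠ 0)
    (h : ω ^ ρ ∣ x) : AccPt x (𝓟 {w | ω ^ σ ∣ w}) := by
  obtain ⟨q, rfl⟩ := (opow_dvd_opow ω (Order.succ_le_of_lt hσ)).trans h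
  have hpos : 0 < ω ^ σ := opow_pos σ omega0_pos
  have hq : 0 < q := pos_iff_ne_zero.2 (right_ne_zero_of_mul hx)
  have hl : Order.IsSuccLimit (ω * q) := isSuccLimit_omega0_mul hq
  rw [opow_succ, mul_assoc] at hx ⊢
  refine accPt_iff_forall_lt.2 ⟨hx, fun p hp => ?_⟩
  obtain ⟨c, hc, hpc⟩ := (lt_mul_iff_of_isSuccLimit hl).1 hp
  exact ⟨_, dvd_mul_right _ c, hpc, mul_lt_mul_of_pos_left hc hpos⟩

end Ordinal

instance compactSpace_omegaPowSucc (α : Ordinal.{u}) : CompactSpace (OmegaPowSucc α) := by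
  rw [← isCompact_iff_compactSpace]
  have : Iio (ω ^ α + 1) = Icc 0 (ω ^ α) := by
    ext x
    simp [Order.lt_add_one_iff]
  rw [this]
  exact isCompact_Icc

theorem firstCountableTopology_omegaPowSucc {α : Ordinal.{u}} (h : α < ω₁) :
    FirstCountableTopology (OmegaPowSucc α) := by
  have := countable_omegaPowSucc h
  have : OrderTopology (OmegaPowSucc α) := orderTopology_of_ordConnected
  have : SecondCountableTopology (OmegaPowSucc α) := by
    refine ⟨_, ?_, OrderTopology.topology_eq_generate_intervals⟩
    refine ((countable_range fun a : OmegaPowSucc α => Ioi a).union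
      (countable_range fun a : OmegaPowSucc α => Iio a)).mono ?_
    rintro s ⟨a, rfl | rfl⟩
    · exact Or.inl ⟨a, rfl⟩
    · exact Or.inr ⟨a, rfl⟩
  infer_instance

theorem accPt_omegaPowSucc_iff {α : Ordinal.{u}} {x : OmegaPowSucc α} {S : Set Ordinal.{u}} :
    AccPt x (𝓟 (((↑) : OmegaPowSucc α → Ordinal) ⁻¹' S)) ↔ AccPt (x : Ordinal) (𝓟 S) :=
  by
  rw [← comap_principal]
  exact (isOpen_Iio.isOpenEmbedding_subtypeVal).accPt_comap_iff

/-- A map under which preimages of convergent sequences are small does not decrease the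
Cantor–Bendixson rank, up to finitely many exceptions. -/
theorem PreservesConv.exists_mapClusterPt_dvd {α γ : Ordinal.{u}} (hα : α < ω₁) (hγ : γ < ω₁)
    {f : OmegaPowSucc α → OmegaPowSucc γ} (hf : PreservesConv f) {ρ : Ordinal.{u}} (hρ : 1 ≤ ρ)
    {x : OmegaPowSucc α} (hx : x ∉ {x | ∃ c, ∃ᶠ s in 𝓝[≠] x, f s = c}) (hx0 : (x : Ordinal) ≠ 0)
    (hdvd : ω ^ ρ ∣ (x : Ordinal)) :
    ∃ y, MapClusterPt y (𝓝[≠] x) f ∧ (y : Ordinal) ≠ 0 ∧ ω ^ ρ ∣ (y : Ordinal) := by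
  have := firstCountableTopology_omegaPowSucc hα
  have := firstCountableTopology_omegaPowSucc hγ
  have hacc : ∀ x ∉ {x | ∃ c, ∃ᶠ s in 𝓝[≠] x, f s = c}, ∀ y, MapClusterPt y (𝓝[≠] x) f →
      AccPt (y : Ordinal) (𝓟 univ) := fun x hx y hy =>
    accPt_omegaPowSucc_iff.1 (hy.accPt (not_frequently.1 fun h => hx ⟨y, h⟩))
  induction ρ using WellFoundedLT.induction generalizing x with
  | ind ρ ih =>
  suffices ∃ y, MapClusterPt y (𝓝[≠] x) f ∧ ∀ σ < ρ, AccPt (y : Ordinal) (𝓟 {w | ω ^ σ ∣ w}) by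
    obtain ⟨y, hy, hy'⟩ := this
    exact ⟨y, hy, (Ordinal.accPt_iff_forall_lt.1 (hacc x hx y hy)).1,
      Ordinal.omega0_opow_dvd_of_accPt hy'⟩
  have hxacc : ∀ σ < ρ, ∃ᶠ w : OmegaPowSucc α in 𝓝[≠] x, ω ^ σ ∣ (w : Ordinal) := fun σ hσ =>
    accPt_iff_frequently_nhdsNE.1
      (accPt_omegaPowSucc_iff.2 (Ordinal.accPt_of_omega0_opow_dvd hσ hx0 hdvd))
  rcases hρ.eq_or_lt with rfl | hρ1
  · have : (𝓝[≠] x).NeBot := ⟨fun h => hxacc 0 zero_lt_one (h ▸ eventually_bot)⟩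
    obtain ⟨y, hy⟩ := exists_clusterPt_of_compactSpace (map f (𝓝[≠] x))
    refine ⟨y, hy, fun σ hσ => ?_⟩
    obtain rfl := Order.lt_one_iff.1 hσ
    simpa using hacc x hx y hy
  obtain ⟨U, hU⟩ := (𝓝[≠] x).exists_antitone_basis
  -- Non-exceptional points `w` of rank at least `σ` exist arbitrarily close to `x`; induction gives
  -- them cluster values of rank at least `σ`. The `max σ 1` meets the bound `1 ≤ ρ` of the
  -- induction.
  have step : ∀ i : Iio ρ × ℕ, ∃ w ∈ U i.2, ∃ y, MapClusterPt y (𝓝[≠] w) f ∧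
      ω ^ (i.1 : Ordinal) ∣ (y : Ordinal) := by
    rintro ⟨⟨σ, hσ⟩, n⟩
    have hσ' : max σ 1 < ρ := max_lt hσ hρ1
    have h0 : ({0} : Set Ordinal.{u}).Finite := finite_singleton 0
    have h0' := (h0.preimage (f := ((↑) : OmegaPowSucc α → Ordinal))
      Subtype.val_injective.injOn).eventually_nhdsNE_notMem x
    obtain ⟨w, hw, hwU, hwE, hw0⟩ := ((hxacc _ hσ').and_eventually ((eventually_mem_set.2 (hU.mem n)).and
      ((hf.finite_frequently_eq.eventually_nhdsNE_notMem x).and h0'))).exists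
    obtain ⟨y, hy, -, hyd⟩ := ih _ hσ' (le_max_right _ _) hwE hw0 hw
    exact ⟨w, hwU, y, hy, (Ordinal.opow_dvd_opow ω (le_max_left _ _)).trans hyd⟩
  choose w hwU Z hZ hZd using step
  have : Nonempty (Iio ρ) := ⟨⟨1, hρ1⟩⟩
  -- Along the directed set `Iio ρ × ℕ` the rank bound grows while `w` tends to `x`; a cluster point
  -- of the values `Z` handles all `σ < ρ` at once.
  obtain ⟨y, hy⟩ := exists_clusterPt_of_compactSpace (map Z atTop)
  replace hy : MapClusterPt y atTop Z := hy
  have hw : Tendsto w atTop (𝓝[≠] x) := by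
    refine hU.tendsto_right_iff.2 fun n _ => ?_
    filter_upwards [eventually_ge_atTop (⟨⟨1, hρ1⟩, n⟩ : Iio ρ × ℕ)] with i hi
    exact hU.antitone hi.2 (hwU i)
  refine ⟨y, mapClusterPt_iff_frequently.2 fun V hV => ?_, fun σ hσ => ?_⟩
  -- A neighbourhood of `y` avoided by `f` near `x` would be avoided near each `w` close to `x`,
  -- although its interior contains some `Z i`.
  · rw [Filter.Frequently]
    intro hcon
    have h1 : ∀ᶠ w in 𝓝[≠] x, ∀ᶠ s in 𝓝[≠] w, f s ∉ V := by
      filter_upwards [eventually_eventually_nhdsWithin.2 hcon, self_mem_nhdsWithin] with w hw hwx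
      rw [isOpen_compl_singleton.nhdsWithin_eq hwx] at hw
      exact hw.filter_mono nhdsWithin_le_nhds
    obtain ⟨i, hi, hi'⟩ := ((mapClusterPt_iff_frequently.1 hy _
      (interior_mem_nhds.2 hV)).and_eventually (hw.eventually h1)).exists
    exact (mapClusterPt_iff_frequently.1 (hZ i) V (mem_interior_iff_mem_nhds.1 hi)) hi'
  -- Eventually `Z i ≠ y`, since `y` is a cluster value at only finitely many points; thus `y` is a
  -- genuine accumulation point of the `Z i`.
  · rw [← accPt_omegaPowSucc_iff, accPt_iff_nhds]
    intro V hV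
    have h1 := hw.eventually ((hf.finite_mapClusterPt y).eventually_nhdsNE_notMem x)
    obtain ⟨i, hi, hi', hiσ⟩ := ((mapClusterPt_iff_frequently.1 hy V hV).and_eventually
      (h1.and (eventually_ge_atTop (⟨⟨σ, hσ⟩, 0⟩ : Iio ρ × ℕ)))).exists
    refine ⟨Z i, ⟨hi, ?_⟩, ?_⟩
    · exact (Ordinal.opow_dvd_opow ω hiσ.1).trans (hZd i)
    · intro h
      exact hi' (show MapClusterPt y (𝓝[≠] (w i)) f from h ▸ hZ i)

/-! ### Bounding the cluster values and non-reducibility -/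

theorem exists_injective_mem_of_infinite {X : Type*} {S : ℕ → Set X} (h : ∀ n, (S n).Infinite) :
    ∃ x : ℕ → X, Function.Injective x ∧ ∃ φ : ℕ → ℕ, StrictMono φ ∧ ∀ n, x n ∈ S (φ n) := by
  classical
  obtain ⟨g, hg, hg'⟩ := exists_seq_of_forall_finset_exists (fun p : ℕ × X => p.2 ∈ S p.1)
    (fun p q => p.1 < q.1 ∧ p.2 ≠ q.2) fun s _ => by
      obtain ⟨x, hx, hxs⟩ := (h (s.sup Prod.fst + 1)).exists_notMem_finset (s.image Prod.snd)
      refine ⟨(s.sup Prod.fst + 1, x), hx, fun p hp => ⟨?_, ?_⟩⟩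
      · exact Nat.lt_succ_of_le (Finset.le_sup (f := Prod.fst) hp)
      · rintro rfl
        exact hxs (Finset.mem_image_of_mem _ hp)
  refine ⟨fun n => (g n).2, ?_, fun n => (g n).1, fun m n hmn => (hg' m n hmn).1, hg⟩
  intro m n hmn
  rcases lt_trichotomy m n with hl | rfl | hl
  · exact ((hg' m n hl).2 hmn).elim
  · rfl
  · exact ((hg' n m hl).2 hmn.symm).elim

/-- Up to finitely many exceptions, the cluster values of a Katětov reduction of `convLT α` to
`convOrd γ`, other than the last point of `ω ^ α + 1`, are bounded below `ω ^ α`. -/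
theorem exists_finite_mapClusterPt_gt {α γ : Ordinal.{u}} (hα : Order.IsSuccLimit α)
    (hcount : α < ω₁) (hγ : γ < ω₁) {f : OmegaPowSucc γ → OmegaPowSucc α}
    (hf : ∀ A ∈ convLT α, f ⁻¹' A ∈ convOrd γ) :
    ∃ β < α, {x | ∃ y, MapClusterPt y (𝓝[≠] x) f ∧ ω ^ β < (y : Ordinal) ∧
      (y : Ordinal) < ω ^ α}.Finite := by
  have := firstCountableTopology_omegaPowSucc hcount
  have := firstCountableTopology_omegaPowSucc hγ
  by_contra! hinf
  obtain ⟨e, he⟩ := (countable_Iio_of_lt_omega_one hcount).exists_eq_range ⟨0, hα.pos⟩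
  let b : ℕ → Ordinal.{u} := fun n => (Finset.range (n + 1)).sup e
  have hb : ∀ n, b n < α := fun n => (Finset.sup_lt_iff hα.pos).2 fun i _ => by
    have : e i ∈ Iio α := he ▸ mem_range_self i
    exact this
  obtain ⟨x, hxinj, φ, hφ, hx⟩ := exists_injective_mem_of_infinite fun n => hinf (b n) (hb n)
  choose y hy hby hyα using hx
  choose s hs hfs hsW using fun n => MapClusterPt.exists_seq_nhdsNE (hy n)
    ((isOpen_Ioi.preimage continuous_subtype_val).mem_nhds (hby n))
  -- The bounds `b (φ n)` eventually pass each `β < α`, so only finitely many of these convergent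
  -- sequences meet `Iio (ω ^ β)`. The preimage of the union, however, accumulates at every `x n`.
  have hA : (⋃ n, range (f ∘ s n)) ∈ convLT α := by
    refine mem_convLT_iff.2 fun β _ hβ => ?_
    obtain ⟨m, rfl⟩ : β ∈ range e := he ▸ hβ
    refine convFamily_mono ?_ (biUnion_mem_convFamily (finite_Iio m) fun n _ =>
      image_mem_convFamily continuous_subtype_val (range_mem_convFamily (hfs n)))
    rintro _ ⟨⟨z, hz, rfl⟩, hzm⟩
    obtain ⟨n, k, rfl⟩ := mem_iUnion.1 hz
    refine mem_iUnion₂.2 ⟨n, mem_Iio.2 (not_le.1 fun hmn => ?_), _, ⟨k, rfl⟩, rfl⟩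
    have h1 : e m ≤ b (φ n) := Finset.le_sup
      (Finset.mem_range.2 (Nat.lt_succ_of_le (hmn.trans (hφ.id_le n))))
    have h2 : ω ^ b (φ n) < (f (s n k) : Ordinal) := hsW n k
    exact ((Ordinal.opow_le_opow_right Ordinal.omega0_pos h1).trans_lt h2).not_gt hzm
  refine Set.Infinite.mono (s := range x) ?_ (infinite_range_of_injective hxinj)
    (finite_accPt_of_mem_convFamily (hf _ hA))
  rintro _ ⟨n, rfl⟩
  exact accPt_of_tendsto_nhdsNE (hs n) fun k => mem_iUnion.2 ⟨n, k, rfl⟩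

theorem not_katetovLE_convLT_convOrd {α : Ordinal.{u}} (hα : Order.IsSuccLimit α)
    (hcount : α < ω₁) : ¬ KatetovLE (convLT α) (convOrd α) := by
  rintro ⟨f, hf⟩
  have := firstCountableTopology_omegaPowSucc hcount
  have hpres : PreservesConv f := fun A hA =>
    finite_accPt_of_mem_convFamily (hf A (convOrd_subset_convLT α hA))
  obtain ⟨β, hβ, hfin⟩ := exists_finite_mapClusterPt_gt hα hcount hcount hf
  let top : OmegaPowSucc α := ⟨ω ^ α, mem_Iio_omegaPow_add_one_iff.2 le_rfl⟩
  have hpos : 0 < ω ^ (β + 1) := Ordinal.opow_pos _ Ordinal.omega0_pos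
  let p : ℕ → OmegaPowSucc α := fun n => ⟨ω ^ (β + 1) * ((n : Ordinal.{u}) + 1), by
    refine mem_Iio_omegaPow_add_one_iff.2 (Ordinal.opow_mul_lt_opow ?_ (hα.succ_lt hβ)).le
    exact_mod_cast Ordinal.natCast_lt_omega0 (n + 1)⟩
  have hp : Function.Injective p := fun m n hmn => by
    have := mul_left_cancel₀ hpos.ne' (congrArg Subtype.val hmn)
    exact_mod_cast Order.succ_injective this
  -- One of the multiples of `ω ^ (β + 1)` avoids all exceptional sets. Excluding the points with
  -- cluster value `top` forces its cluster values below `ω ^ α`.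
  obtain ⟨_, ⟨n, rfl⟩, hn⟩ := (infinite_range_of_injective hp).exists_notMem_finite
    ((hpres.finite_frequently_eq.union (hpres.finite_mapClusterPt top)).union hfin)
  simp only [mem_union, not_or] at hn
  obtain ⟨⟨hn1, hn2⟩, hn3⟩ := hn
  obtain ⟨y, hy, hy0, hyd⟩ := hpres.exists_mapClusterPt_dvd hcount hcount (ρ := β + 1)
    (by simp) hn1
    (mul_ne_zero hpos.ne' (Order.lt_add_one_iff.2 zero_le).ne') (dvd_mul_right _ _)
  refine hn3 ⟨y, hy, ?_, ?_⟩
  · refine lt_of_lt_of_le ?_ (Ordinal.le_of_dvd hy0 hyd)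
    exact (Ordinal.opow_lt_opow_iff_right Ordinal.one_lt_omega0).2 (Order.lt_add_one_iff.2 le_rfl)
  · refine (mem_Iio_omegaPow_add_one_iff.1 y.2).lt_of_ne fun h => hn2 ?_
    have : y = top := Subtype.ext h
    exact show MapClusterPt top _ f from this ▸ hy

theorem mainTheorem1 (α : Ordinal.{u}) (hα : Order.IsSuccLimit α) (hcount : α < ω₁) :
    -- `conv_{<α}` is an ideal
    IsIdealOn (convLT α) ∧
    -- it is a lower bound of the `conv_β`, `2 ≤ β < α`
    (∀ β : Ordinal.{u}, 2 ≤ β → β < α → KatetovLE (convLT α) (convOrd β)) ∧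
    -- it is above every lower bound
    (∀ (Y : Type v) (I : Set (Set Y)), IsIdealOn I →
      (∀ β : Ordinal.{u}, 2 ≤ β → β < α → KatetovLE I (convOrd β)) →
        KatetovLE I (convLT α)) ∧
    -- it is strictly above `conv_α`
    KatetovLE (convOrd α) (convLT α) ∧
    ¬ KatetovLE (convLT α) (convOrd α) ∧
    -- hence `conv_α` is not a greatest lower bound
    ¬ (∀ (Y : Type (u + 1)) (I : Set (Set Y)), IsIdealOn I →
      (∀ β : Ordinal.{u}, 2 ≤ β → β < α → KatetovLE I (convOrd β)) →
        KatetovLE I (convOrd α)) := by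
  refine ⟨isIdealOn_convLT hα, fun β => katetovLE_convLT_convOrd,
    fun Y I _ h => KatetovLE.convLT hα hcount h, ⟨id, convOrd_subset_convLT α⟩,
    not_katetovLE_convLT_convOrd hα hcount, fun h => ?_⟩
  -- The lower bound not below `conv_α` is `conv_{<α}` itself.
  exact not_katetovLE_convLT_convOrd hα hcount
    (h _ _ (isIdealOn_convLT hα) fun β => katetovLE_convLT_convOrd)
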